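/- Let $L$ be a relational first-order language and let $\mathbf{K}$ be a Fraïssé structure, i.e. a countably infinite ultrahomogeneous $L$-structure (every isomorphism between finite substructures of $\mathbf{K}$ extends to an automorphism of $\mathbf{K}$). Put $G=\mathrm{Aut}(\mathbf{K})$, and fix finite substructures $\mathbf{A}_0\subseteq\mathbf{A}_1\subseteq\cdots$ of $\mathbf{K}$ with $\mathbf{K}=\bigcup_n\mathbf{A}_n$. Let $H_n=\mathrm{Emb}(\mathbf{A}_n,\mathbf{K})$ be the set of embeddings of $\mathbf{A}_n$ into $\mathbf{K}$, considered as a discrete space, and let $\beta H_n$ be the space of ultrafilters on $H_n$. The group $G$ acts on $2^{H_m}$ (with the product topology) on the right by $(\chi\cdot g)(f)=\chi(g\circ f)$. A set $T\subseteq H_m$ is called thick if $\chi_{H_m}\in\overline{\chi_T\cdot G}$, where $\chi_S$ denotes the characteristic function of $S\subseteq H_m$. The Samuel compactification of $G$ is realized as the inverse limit $S(G)=\varprojlim\beta H_n$ along the maps $\beta H_n\to\beta H_m$ ($m\le n$) induced by restriction $x\mapsto x|_{\mathbf{A}_m}$. For $\alpha\in S(G)$ and $f\in H_m$, let $\alpha\cdot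 f$ be the ultrafilter on $H_m$ given by $$S\in\alpha\cdot f\iff\{x\in H_n: x\circ f\in S\}\in\alpha(n),$$ where $n\ge m$ is any index with $f(\mathbf{A}_m)\subseteq\mathbf{A}_n$. Then $S(G)$ is a semigroup under the multiplication $$S\in(\alpha\gamma)(m)\iff\{f\in H_m: S\in\alpha\cdot f\}\in\gamma(m)\qquad(S\subseteq H_m).$$ A right ideal of $S(G)$ is a non-empty set $Y\subseteq S(G)$ with $Y\cdot S(G)\subseteq Y$; it is minimal if it contains no strictly smaller right ideal. **Statement.** For every $m\in\mathbb{N}$ and every $T\subseteq H_m$, the set $\tilde T=\{\alpha\in S(G): T\in\alpha(m)\}$ is clopen in $S(G)$, and $T$ is thick if and only if $\tilde T$ contains a minimal right ideal of $S(G)$. -/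

import Mathlib

open FirstOrder FirstOrder.Language

/-- A right ideal of a semigroup: a nonempty subset `Y` with `Y * S ⊆ Y`. -/
def IsRightIdeal {S : Type*} [Mul S] (Y : Set S) : Prop :=
  Y.Nonempty ∧ ∀ y ∈ Y, ∀ s : S, y * s ∈ Y

/-- A minimal right ideal: a right ideal that contains no strictly smaller right ideal. -/
def IsMinimalRightIdeal {S : Type*} [Mul S] (Y : Set S) : Prop :=
  Minimal IsRightIdeal Y

/-- An exhaustion `A 0 ≤ A 1 ≤ ...` of a structure `K` by finite substructures. -/
structure Exhaustion (L : Language) (K : Type*) [L.Structure K] where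
  A : ℕ → L.Substructure K
  finite : ∀ n, Finite (A n)
  mono : Monotone A
  exhausts : ∀ x : K, ∃ n, x ∈ A n

namespace Exhaustion

variable {L : Language} {K : Type*} [L.Structure K] (E : Exhaustion L K)

/-- `E.H m` is the (discrete) set of embeddings of `A m` into `K`. -/
abbrev H (m : ℕ) : Type _ := E.A m ↪[L] K

/-- The dual map `x ↦ x ∘ f` from `H n` to `H m` of an embedding `f` of `A m` into `A n`. -/
def dual {m n : ℕ} (f : E.A m ↪[L] E.A n) : E.H n → E.H m := fun x => x.comp f

/-- The inclusion embedding of `A m` into `A n`, for `m ≤ n`. -/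
def incl {m n : ℕ} (h : m ≤ n) : E.A m ↪[L] E.A n := Substructure.inclusion (E.mono h)

open Classical in
/-- The characteristic function of `T ⊆ H m`, a point of the product space `2 ^ (H m)`. -/
noncomputable def chi {m : ℕ} (T : Set (E.H m)) : E.H m → Bool := fun f => decide (f ∈ T)

/-- The right shift action of `Aut K` on `2 ^ (H m)`: `(χ · g) f = χ (g ∘ f)`. -/
def shift {m : ℕ} (χ : E.H m → Bool) (g : K ≃[L] K) : E.H m → Bool :=
  fun f => χ (g.toEmbedding.comp f)

/-- `T ⊆ H m` is thick if the constant function `1` lies in the closure of the orbit of the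
characteristic function of `T` under the right shift action of `Aut K` (product topology). -/
def IsThick {m : ℕ} (T : Set (E.H m)) : Prop :=
  E.chi Set.univ ∈ closure (Set.range fun g : K ≃[L] K => E.shift (E.chi T) g)

/-- The inverse limit of the spaces `β (H n)` of ultrafilters along the maps induced by the
inclusions `A m ≤ A n`: the Samuel compactification of `Aut K`. -/
structure SG where
  ult : ∀ n, Ultrafilter (E.H n)
  compat : ∀ m n (h : m ≤ n), Ultrafilter.map (E.dual (E.incl h)) (ult n) = ult m

/-- The inverse limit topology. -/
instance : TopologicalSpace E.SG := TopologicalSpace.induced SG.ult inferInstance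

theorem exists_level {m : ℕ} (f : E.H m) : ∃ n, m ≤ n ∧ ∀ a, f a ∈ E.A n := by
  have := E.finite m
  choose k hk using fun a : E.A m => E.exhausts (f a)
  obtain ⟨N, hN⟩ := (Set.finite_range k).bddAbove
  exact ⟨max m N, le_max_left _ _,
    fun a => E.mono ((hN ⟨a, rfl⟩).trans (le_max_right _ _)) (hk a)⟩

/-- A level `n ≥ m` such that the range of `f` is contained in `A n`. -/
noncomputable def level {m : ℕ} (f : E.H m) : ℕ := (E.exists_level f).choose

/-- The embedding `f` of `A m` into `K`, seen as an embedding of `A m` into `A (level f)`. -/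
noncomputable def toLevel {m : ℕ} (f : E.H m) : E.A m ↪[L] E.A (E.level f) :=
  f.codRestrict (E.A (E.level f)) (E.exists_level f).choose_spec.2

/-- The ultrafilter `α · f` on `H m`: `S ∈ α · f` iff `{x ∈ H n | x ∘ f ∈ S} ∈ α n`,
where `n` is large enough for `A n` to contain the range of `f`. -/
noncomputable def act (α : E.SG) {m : ℕ} (f : E.H m) : Ultrafilter (E.H m) :=
  Ultrafilter.map (E.dual (E.toLevel f)) (α.ult (E.level f))

/-- The definition of `α · f` does not depend on the choice of `n`. -/
theorem act_eq (α : E.SG) {m n : ℕ} (f : E.H m) (hf : ∀ a, f a ∈ E.A n) :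
    E.act α f = Ultrafilter.map (E.dual (f.codRestrict (E.A n) hf)) (α.ult n) := by
  have key : ∀ (k N : ℕ) (h : k ≤ N) (hk : ∀ a, f a ∈ E.A k) (hN : ∀ a, f a ∈ E.A N),
      Ultrafilter.map (E.dual (f.codRestrict (E.A k) hk)) (α.ult k) =
        Ultrafilter.map (E.dual (f.codRestrict (E.A N) hN)) (α.ult N) := by
    intro k N h hk hN
    rw [← α.compat k N h, Ultrafilter.map_map]
    rfl
  rcases le_total (E.level f) n with h | h
  · exact key _ _ h _ _
  · exact (key _ _ h _ _).symm

theorem mem_act_iff (α : E.SG) {m n : ℕ} (f : E.H m) (hf : ∀ a, f a ∈ E.A n)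
    (S : Set (E.H m)) :
    S ∈ E.act α f ↔ {x : E.H n | x.comp (f.codRestrict (E.A n) hf) ∈ S} ∈ α.ult n := by
  rw [E.act_eq α f hf]
  rfl

theorem map_act (α : E.SG) {m n : ℕ} (h : m ≤ n) (f : E.H n) :
    Ultrafilter.map (E.dual (E.incl h)) (E.act α f) = E.act α (E.dual (E.incl h) f) := by
  rw [E.act_eq α (E.dual (E.incl h) f) (n := E.level f)
    (fun a => (E.exists_level f).choose_spec.2 _), act, Ultrafilter.map_map]
  rfl

/-- The semigroup multiplication of `S(G)`:
`S ∈ (α * γ) m` iff `{f ∈ H m | S ∈ α · f} ∈ γ m`. -/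
noncomputable instance : Mul E.SG where
  mul α γ := ⟨fun m => Ultrafilter.bind (γ.ult m) (fun f => E.act α f), by
    intro m n h
    ext S
    have h1 : ∀ f : E.H n, E.dual (E.incl h) ⁻¹' S ∈ E.act α f ↔
        S ∈ E.act α (E.dual (E.incl h) f) := fun f => by
      rw [← E.map_act α h f, Ultrafilter.mem_map]
    rw [Ultrafilter.mem_map, ← γ.compat m n h]
    change {f : E.H n | E.dual (E.incl h) ⁻¹' S ∈ E.act α f} ∈ γ.ult n ↔
      {f : E.H n | S ∈ E.act α (E.dual (E.incl h) f)} ∈ γ.ult n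
    simp only [h1]⟩

theorem mem_mul_iff (α γ : E.SG) {m : ℕ} (S : Set (E.H m)) :
    S ∈ (α * γ).ult m ↔ {f : E.H m | S ∈ E.act α f} ∈ γ.ult m :=
  Iff.rfl

noncomputable instance : Semigroup E.SG where
  mul_assoc α γ δ := by
    suffices h : (α * γ * δ).ult = (α * (γ * δ)).ult by
      cases h' : α * γ * δ; cases h'' : α * (γ * δ); simp_all
    funext m
    ext S
    rw [E.mem_mul_iff, E.mem_mul_iff, E.mem_mul_iff]
    have h : ∀ f : E.H m, S ∈ E.act (α * γ) f ↔ {f' | S ∈ E.act α f'} ∈ E.act γ f := by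
      intro f
      have hn := (E.exists_level f).choose_spec.2
      rw [E.mem_act_iff (α * γ) f hn, E.mem_act_iff γ f hn, E.mem_mul_iff]
      have h2 : ∀ x : E.H (E.level f),
          {y : E.H (E.level f) | y.comp (f.codRestrict (E.A (E.level f)) hn) ∈ S} ∈ E.act α x ↔
            S ∈ E.act α (x.comp (f.codRestrict (E.A (E.level f)) hn)) := by
        intro x
        rw [E.mem_act_iff α (x.comp (f.codRestrict (E.A (E.level f)) hn)) (n := E.level x)
          (fun a => (E.exists_level x).choose_spec.2 _)]
        rfl
      exact iff_of_eq (congrArg (· ∈ γ.ult (E.level f)) (Set.ext h2))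
    exact iff_of_eq (congrArg (· ∈ δ.ult m) (Set.ext h))

/-- For `T ⊆ H m`, the set of those `α ∈ S(G)` with `T ∈ α m`. -/
def tilde {m : ℕ} (T : Set (E.H m)) : Set E.SG := {α | T ∈ α.ult m}

end Exhaustion

/-! Both conditions say that some `α` has `T ∈ α · f` for every `f ∈ H m`. Thickness gives, for each
finite set of `f`, an automorphism with this property, and compactness of `S(G)` yields `α`;
ultrahomogeneity gives the converse (`isThick_iff_exists_forall_mem_act`). On the other side, such
an `α` is exactly one with `α * S(G) ⊆ T̃` (`range_mul_subset_tilde_iff`); every right ideal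
contains such a translate, and compactness puts a minimal right ideal inside each translate. -/

section RightIdeals

variable {S : Type*} [Semigroup S]

theorem isRightIdeal_range_mul [Nonempty S] (a : S) :
    IsRightIdeal (Set.range fun s : S => a * s) := by
  refine ⟨Set.range_nonempty _, ?_⟩
  rintro _ ⟨s, rfl⟩ t
  exact ⟨s * t, (mul_assoc a s t).symm⟩

theorem IsRightIdeal.range_mul_subset {Y : Set S} (hY : IsRightIdeal Y) {y : S} (hy : y ∈ Y) :
    Set.range (fun s : S => y * s) ⊆ Y := by
  rintro _ ⟨s, rfl⟩
  exact hY.2 y hy s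

variable [TopologicalSpace S] [CompactSpace S] [T2Space S]

/-- In a compact Hausdorff semigroup with continuous left translations, every right ideal contains
a minimal right ideal. -/
theorem IsRightIdeal.exists_minimal_subset (hc : ∀ a : S, Continuous fun s : S => a * s)
    {Y : Set S} (hY : IsRightIdeal Y) : ∃ M, IsMinimalRightIdeal M ∧ M ⊆ Y := by
  obtain ⟨a, ha⟩ := hY.1
  have : Nonempty S := ⟨a⟩
  have hclosed : ∀ b : S, IsClosed (Set.range fun s : S => b * s) := fun b =>
    (isCompact_range (hc b)).isClosed
  -- Zorn is run on closed right ideals, so that chains have nonempty intersection by compactness.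
  obtain ⟨M, hMa, hM⟩ := zorn_superset_nonempty {Z : Set S | IsRightIdeal Z ∧ IsClosed Z}
    (fun c hcR hchain hne => by
      refine ⟨⋂₀ c, ⟨⟨?_, ?_⟩, isClosed_sInter fun Z hZ => (hcR hZ).2⟩,
        fun Z hZ => Set.sInter_subset_of_mem hZ⟩
      · have := hne.to_subtype
        exact IsCompact.nonempty_sInter_of_directed_nonempty_isCompact_isClosed
          (fun U hU V hV => (hchain.total hU hV).elim
            (fun h => ⟨U, hU, subset_rfl, h⟩) fun h => ⟨V, hV, h, subset_rfl⟩) (fun Z hZ => (hcR hZ).1.1)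
          (fun Z hZ => (hcR hZ).2.isCompact) (fun Z hZ => (hcR hZ).2)
      · exact fun y hy s Z hZ => (hcR hZ).1.2 y (hy Z hZ) s)
    (Set.range fun s : S => a * s) ⟨isRightIdeal_range_mul a, hclosed a⟩
  refine ⟨M, ⟨hM.prop.1, fun Z hZ hZM => ?_⟩, hMa.trans (hY.range_mul_subset ha)⟩
  -- Minimality passes from closed to arbitrary right ideals: `Z` contains the closed right ideal `z
  -- * S`.
  obtain ⟨z, hz⟩ := hZ.1
  have hzZ := hZ.range_mul_subset hz
  exact (hM.2 ⟨isRightIdeal_range_mul z, hclosed z⟩ (hzZ.trans hZM)).trans hzZ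

end RightIdeals

theorem isClopen_setOf_mem_ultrafilter {α : Type*} (s : Set α) :
    IsClopen {u : Ultrafilter α | s ∈ u} :=
  ⟨ultrafilter_isClosed_basic s, ultrafilter_isOpen_basic s⟩

theorem continuous_ultrafilter_iff {X α : Type*} [TopologicalSpace X] {F : X → Ultrafilter α} :
    Continuous F ↔ ∀ s : Set α, IsOpen {x | s ∈ F x} := by
  refine ⟨fun hF s => (ultrafilter_isOpen_basic s).preimage hF, fun h => ?_⟩
  refine ultrafilterBasis_is_basis.continuous_iff.2 ?_
  rintro _ ⟨s, rfl⟩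
  exact h s

theorem Ultrafilter.continuous_map {α β : Type*} (f : α → β) :
    Continuous (Ultrafilter.map f) :=
  continuous_ultrafilter_iff.2 fun s => ultrafilter_isOpen_basic (f ⁻¹' s)

namespace Exhaustion

variable {L : Language} {K : Type*} [L.Structure K] (E : Exhaustion L K)

theorem ult_injective : Function.Injective (SG.ult : E.SG → ∀ n, Ultrafilter (E.H n)) := by
  rintro ⟨a, _⟩ ⟨b, _⟩ rfl
  rfl

theorem continuous_ult : Continuous (SG.ult : E.SG → ∀ n, Ultrafilter (E.H n)) :=
  continuous_induced_dom

theorem continuous_ult_apply (n : ℕ) : Continuous fun α : E.SG => α.ult n :=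
  (continuous_apply n).comp E.continuous_ult

theorem isClosed_range_ult :
    IsClosed (Set.range (SG.ult : E.SG → ∀ n, Ultrafilter (E.H n))) := by
  have : Set.range (SG.ult : E.SG → ∀ n, Ultrafilter (E.H n)) =
      {u | ∀ m n (h : m ≤ n), Ultrafilter.map (E.dual (E.incl h)) (u n) = u m} := by
    ext u
    exact ⟨fun ⟨α, hα⟩ => hα ▸ α.compat, fun h => ⟨⟨u, h⟩, rfl⟩⟩
  rw [this]
  simp only [Set.ofPred_forall]
  exact isClosed_iInter fun m => isClosed_iInter fun n => isClosed_iInter fun h =>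
    isClosed_eq ((Ultrafilter.continuous_map _).comp (continuous_apply n)) (continuous_apply m)

instance : T2Space E.SG :=
  T2Space.of_injective_continuous E.ult_injective E.continuous_ult

instance : CompactSpace E.SG :=
  Topology.IsClosedEmbedding.compactSpace
    (f := (SG.ult : E.SG → ∀ n, Ultrafilter (E.H n)))
    ⟨⟨⟨rfl⟩, E.ult_injective⟩, E.isClosed_range_ult⟩

theorem isClopen_tilde {m : ℕ} (T : Set (E.H m)) : IsClopen (E.tilde T) :=
  (isClopen_setOf_mem_ultrafilter T).preimage (E.continuous_ult_apply m)

/-- The right factor enters only through the outer ultrafilter, so preimages of basic clopen sets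
are again of the form `tilde`. -/
theorem continuous_mul_left (α : E.SG) : Continuous fun γ : E.SG => α * γ := by
  refine continuous_induced_rng.2 (continuous_pi fun m => continuous_ultrafilter_iff.2 fun S => ?_)
  exact (E.isClopen_tilde {f : E.H m | S ∈ E.act α f}).isOpen

theorem isClosed_setOf_mem_act {m : ℕ} (T : Set (E.H m)) (f : E.H m) :
    IsClosed {α : E.SG | T ∈ E.act α f} :=
  (E.isClopen_tilde (E.dual (E.toLevel f) ⁻¹' T)).isClosed

/-- The canonical image in `S(G)` of an automorphism of `K`. -/
def ofAut (g : K ≃[L] K) : E.SG where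
  ult n := pure (g.toEmbedding.comp (E.A n).subtype)
  compat m n h := by
    rw [Ultrafilter.map_pure]
    rfl

theorem mem_act_ofAut_iff {m : ℕ} (g : K ≃[L] K) (f : E.H m) (S : Set (E.H m)) :
    S ∈ E.act (E.ofAut g) f ↔ g.toEmbedding.comp f ∈ S :=
  Iff.rfl

/-- A basic neighbourhood in the product constrains only finitely many coordinates. -/
theorem isThick_iff {m : ℕ} (T : Set (E.H m)) :
    E.IsThick T ↔ ∀ F : Finset (E.H m), ∃ g : K ≃[L] K, ∀ f ∈ F, g.toEmbedding.comp f ∈ T := by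
  have hchi : ∀ (f : E.H m) (g : K ≃[L] K),
      E.shift (E.chi T) g f = E.chi Set.univ f ↔ g.toEmbedding.comp f ∈ T := fun f g => by
    simp [shift, chi]
  rw [IsThick, mem_closure_iff]
  constructor
  · intro h F
    obtain ⟨_, hmem, g, rfl⟩ := h ((F : Set (E.H m)).pi fun f => {E.chi Set.univ f})
      (isOpen_set_pi F.finite_toSet fun _ _ => isOpen_discrete _) fun _ _ => rfl
    exact ⟨g, fun f hf => (hchi f g).1 (hmem f hf)⟩
  · intro h U hU hmem
    obtain ⟨F, u, hu, hsub⟩ := isOpen_pi_iff.1 hU _ hmem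
    obtain ⟨g, hg⟩ := h F
    refine ⟨_, hsub fun f hf => ?_, g, rfl⟩
    have : E.shift (E.chi T) g f = E.chi Set.univ f := (hchi f g).2 (hg f hf)
    exact this.symm.subst (motive := (· ∈ u f)) (hu f hf).2

theorem exists_aut_extending (hK : L.IsUltrahomogeneous K) {n : ℕ} (x : E.H n) :
    ∃ g : K ≃[L] K, g.toEmbedding.comp (E.A n).subtype = x := by
  have := E.finite n
  obtain ⟨g, hg⟩ := hK (E.A n)
    (Substructure.fg_iff_exists_fin_generating_family.2 (by
      obtain ⟨k, ⟨e⟩⟩ := Finite.exists_equiv_fin (E.A n)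
      refine ⟨k, fun i => (e.symm i : K), ?_⟩
      have : Set.range (fun i => (e.symm i : K)) = (E.A n : Set K) := by
        ext a
        exact ⟨fun ⟨i, hi⟩ => hi ▸ (e.symm i).2, fun ha => ⟨e ⟨a, ha⟩, by simp⟩⟩
      rw [this, Substructure.closure_eq])) x
  exact ⟨g, hg.symm⟩

theorem exists_common_level {m : ℕ} (F : Finset (E.H m)) :
    ∃ n, ∀ f ∈ F, ∀ a, f a ∈ E.A n := by
  refine ⟨F.sup E.level, fun f hf a => ?_⟩
  exact E.mono (Finset.le_sup hf) ((E.exists_level f).choose_spec.2 a)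

theorem isThick_iff_exists_forall_mem_act (hK : L.IsUltrahomogeneous K) {m : ℕ}
    (T : Set (E.H m)) : E.IsThick T ↔ ∃ α : E.SG, ∀ f : E.H m, T ∈ E.act α f := by
  rw [isThick_iff]
  constructor
  · intro h
    -- The finite intersection property is witnessed by images of automorphisms.
    obtain ⟨α, hα⟩ := CompactSpace.iInter_nonempty (t := fun f => {α : E.SG | T ∈ E.act α f})
      (E.isClosed_setOf_mem_act T) fun F => by
        obtain ⟨g, hg⟩ := h F
        exact ⟨E.ofAut g, Set.mem_iInter₂.2 fun f hf => (E.mem_act_ofAut_iff g f T).2 (hg f hf)⟩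
    exact ⟨α, fun f => Set.mem_iInter.1 hα f⟩
  · rintro ⟨α, hα⟩ F
    -- At a level containing the ranges of all `f ∈ F`, finitely many sets of `α n` share a point
    -- `x`, which extends to an automorphism.
    obtain ⟨n, hn⟩ := E.exists_common_level F
    have hmem : (⋂ f : F, {x : E.H n | x.comp (f.1.codRestrict (E.A n) (hn f f.2)) ∈ T}) ∈
        α.ult n :=
      Filter.iInter_mem.2 fun f => (E.mem_act_iff α f.1 (hn f f.2) T).1 (hα f)
    obtain ⟨x, hx⟩ := (α.ult n).nonempty_of_mem hmem
    obtain ⟨g, rfl⟩ := E.exists_aut_extending hK x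
    exact ⟨g, fun f hf => Set.mem_iInter.1 hx ⟨f, hf⟩⟩

theorem range_mul_subset_tilde_iff (hK : L.IsUltrahomogeneous K) {m : ℕ} (T : Set (E.H m))
    (α : E.SG) :
    Set.range (fun γ : E.SG => α * γ) ⊆ E.tilde T ↔ ∀ f : E.H m, T ∈ E.act α f := by
  constructor
  · intro h f
    obtain ⟨g, rfl⟩ := E.exists_aut_extending hK f
    -- `ofAut g` is principal at `f` on level `m`, so level `m` of `α * ofAut g` is `α · f`.
    exact h ⟨E.ofAut g, rfl⟩
  · rintro h _ ⟨γ, rfl⟩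
    exact (E.mem_mul_iff α γ T).2 (Filter.mem_of_superset Filter.univ_mem fun f _ => h f)

end Exhaustion

theorem mainTheorem3 {L : FirstOrder.Language} [L.IsRelational]
    {K : Type*} [L.Structure K] [Countable K] [Infinite K] (hK : L.IsUltrahomogeneous K)
    (E : Exhaustion L K) (m : ℕ) (T : Set (E.H m)) :
    IsClopen (E.tilde T) ∧
      (E.IsThick T ↔ ∃ Y : Set E.SG, IsMinimalRightIdeal Y ∧ Y ⊆ E.tilde T) := by
  refine ⟨E.isClopen_tilde T, ?_⟩
  rw [E.isThick_iff_exists_forall_mem_act hK]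
  constructor
  · rintro ⟨α, hα⟩
    have : Nonempty E.SG := ⟨α⟩
    obtain ⟨M, hM, hMα⟩ := (isRightIdeal_range_mul α).exists_minimal_subset E.continuous_mul_left
    exact ⟨M, hM, hMα.trans ((E.range_mul_subset_tilde_iff hK T α).2 hα)⟩
  · rintro ⟨Y, hY, hYT⟩
    obtain ⟨α, hα⟩ := hY.prop.1
    exact ⟨α, (E.range_mul_subset_tilde_iff hK T α).1 ((hY.prop.range_mul_subset hα).trans hYT)⟩
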